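/- For a linear subspace $V\subseteq\{0,1\}^n=\mathbb F_2^n$, let $|V\rangle=\frac1{\sqrt{|V|}}\sum_{x\in V}|x\rangle$ be its coset state. A QMDD on $n$ qubits is a finite rooted directed acyclic graph with a unique leaf (level $0$, value $1$) and a root at level $n$. For some order of the $n$ variables, all nodes on one level $k\in\{1,\dots,n\}$ read the same variable, and distinct levels read distinct variables. Every node has a low and a high edge with complex weights; edges of nonzero weight go from level $k$ to level $k-1$ (edges of weight $0$ may go to any lower level), and a weighted root edge points to the root. The QMDD represents the state $\sum_x f(x)|x\rangle$, where $f(x)$ is the product of the weights on the path from the root edge to the leaf that follows the low edge where the variable read is $0$ and the high edge where it is $1$. Its size is its number of non-leaf nodes; it need not be reduced. There is a constant $c>0$ such that, for $V$ drawn uniformly at random from all linear subspaces of $\{0,1\}^n$, the probability that every QMDD representing $|V\rangle$ (in any variable order) has size at least $2^{cn}/(2n)$ tends to $1$ as $n\to\infty$. -/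

import Mathlib

open Filter Topology

/-- Bit strings of length `n`, with bitwise XOR as addition: the vector space `𝔽₂ⁿ`. -/
abbrev BitString (n : ℕ) : Type := Fin n → ZMod 2

/-- The level of the target of an edge in a decision diagram with node set `N`. The leaf (`none`)
has level `0`; a node whose index is the `i`-th element of `Fin n` (counting from `0`) has
level `i + 1`. -/
def ddLevel {n : ℕ} {N : Type} (index : N → Fin n) : Option N → ℕ
  | none => 0
  | some v => (index v : ℕ) + 1

/-- A quantum multi-valued decision diagram (QMDD) on `n` qubits: a finite levelled directed acyclic
graph with a unique leaf (`none`), in which every node has a low and a high edge with complex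
weights, and with a weighted root edge to the (unique) root at level `n`.

Edges of nonzero weight lead exactly one level down. An edge of weight `0` may end at any
lower level (a zero stub). All nodes on one level read the same variable: `order` is the variable
order, which is an arbitrary one. The diagram need not be reduced. -/
structure QMDD (n : ℕ) where
  Node : Type
  [fintypeNode : Fintype Node]
  order : Equiv.Perm (Fin n)
  index : Node → Fin n
  low : Node → Option Node
  high : Node → Option Node
  lowLabel : Node → ℂ
  highLabel : Node → ℂ
  root : Option Node
  rootLabel : ℂ
  low_level_le : ∀ v, ddLevel index (low v) ≤ (index v : ℕ)
  high_level_le : ∀ v, ddLevel index (high v) ≤ (index v : ℕ)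
  low_level : ∀ v, lowLabel v ≠ 0 → ddLevel index (low v) = (index v : ℕ)
  high_level : ∀ v, highLabel v ≠ 0 → ddLevel index (high v) = (index v : ℕ)
  root_level : ddLevel index root = n

namespace QMDD

attribute [instance] QMDD.fintypeNode

variable {n : ℕ}

/-- The product of the edge weights met when the diagram is traversed from the given node down to
the leaf, taking the low edge if the variable read has value `0` and the high edge otherwise. -/
noncomputable def eval (D : QMDD n) (x : BitString n) : Option D.Node → ℂ
  | none => 1
  | some v =>
      if x (D.order (D.index v)) = 0 then D.lowLabel v * D.eval x (D.low v)
      else D.highLabel v * D.eval x (D.high v)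
termination_by e => ddLevel D.index e
decreasing_by
  · exact Nat.lt_succ_of_le (D.low_level_le v)
  · exact Nat.lt_succ_of_le (D.high_level_le v)

/-- The (amplitude function of the) `n`-qubit state represented by a QMDD. -/
noncomputable def state (D : QMDD n) : BitString n → ℂ :=
  fun x => D.rootLabel * D.eval x D.root

/-- The size of a QMDD: its number of nodes, the leaf not counted. -/
def size (D : QMDD n) : ℕ := Fintype.card D.Node

end QMDD

/-- The computational basis state `|x⟩`. -/
noncomputable def ket {n : ℕ} (x : BitString n) : BitString n → ℂ := Pi.single x 1

open Classical in
/-- The coset state `|C⟩ = |C|^{-1/2} ∑_{x ∈ C} |x⟩` of a (coset) `C ⊆ {0,1}ⁿ`. -/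
noncomputable def cosetState {n : ℕ} (C : Set (BitString n)) : BitString n → ℂ :=
  ((1 / Real.sqrt (C.ncard : ℝ) : ℝ) : ℂ) • ∑ x : BitString n with x ∈ C, ket x

/-- The probability that a vector space `V ⊆ {0,1}ⁿ`, drawn uniformly at random from all linear
subspaces of `𝔽₂ⁿ`, has the property `P`. -/
noncomputable def subspaceProb (n : ℕ) (P : Submodule (ZMod 2) (BitString n) → Prop) : ℝ :=
  (Nat.card {V : Submodule (ZMod 2) (BitString n) // P V} : ℝ) /
    (Nat.card (Submodule (ZMod 2) (BitString n)) : ℝ)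

/-! Cut a QMDD at level `k`. Two strings of nonzero amplitude that reach the same edge target at
this level can be spliced: the upper part of one with the lower part of the other again has nonzero
amplitude. For `|V⟩`, with `A` the `k` variables read below the cut, two such strings of `V` differ
by an element of `V_A ⊕ V_{Aᶜ}`, the sums of vectors of `V` supported on one side. So a complement
of this sum in `V` injects into the nodes and the leaf (`exists_complement_card_le`).

Hence a small diagram forces `V` to be generated by a subspace of each half and few further vectors.
For `k = n/2` and at most `n/16` further vectors there are only `2^(3n²/16 + O(n))` such `V`, over
all choices of `A`, against at least about `2^(n²/4)` subspaces in total. -/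

namespace QMDD

variable {n : ℕ}

/-! ### Cutting a QMDD at a level -/

theorem eval_some (D : QMDD n) (x : BitString n) (v : D.Node) :
    D.eval x (some v) = if x (D.order (D.index v)) = 0 then D.lowLabel v * D.eval x (D.low v)
      else D.highLabel v * D.eval x (D.high v) := by
  rw [eval]

/-- The value at an edge depends only on the variables read below it. -/
theorem eval_congr (D : QMDD n) (e : Option D.Node) (x y : BitString n)
    (h : ∀ i : Fin n, (i : ℕ) < ddLevel D.index e → x (D.order i) = y (D.order i)) :
    D.eval x e = D.eval y e := by
  induction hl : ddLevel D.index e using Nat.strong_induction_on generalizing e with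
  | _ l ih =>
    subst hl
    cases e with
    | none => simp [eval]
    | some v =>
      have hv : x (D.order (D.index v)) = y (D.order (D.index v)) := h _ (Nat.lt_succ_self _)
      have hlow := D.low_level_le v
      have hhigh := D.high_level_le v
      rw [eval_some, eval_some, hv,
        ih _ (Nat.lt_succ_of_le hlow) (D.low v)
          (fun i hi => h i (lt_trans hi (Nat.lt_succ_of_le hlow))) rfl,
        ih _ (Nat.lt_succ_of_le hhigh) (D.high v)
          (fun i hi => h i (lt_trans hi (Nat.lt_succ_of_le hhigh))) rfl]

/-- A path of nonzero weight passes through each level below its start, and whether a string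
sharing the upper part of the path is accepted is decided from there on. -/
theorem exists_edge_at_level (D : QMDD n) (k : ℕ) (x : BitString n) (e : Option D.Node)
    (hk : k ≤ ddLevel D.index e) (hx : D.eval x e ≠ 0) :
    ∃ e' : Option D.Node, ddLevel D.index e' = k ∧
      ∀ y : BitString n, (∀ i : Fin n, k ≤ i → y (D.order i) = x (D.order i)) →
        (D.eval y e ≠ 0 ↔ D.eval y e' ≠ 0) := by
  induction hl : ddLevel D.index e using Nat.strong_induction_on generalizing e with
  | _ l ih =>
    subst hl
    rcases hk.eq_or_lt with hk | hk
    · exact ⟨e, hk.symm, fun _ _ => Iff.rfl⟩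
    cases e with
    | none => simp [ddLevel] at hk
    | some v =>
      have hkv : k ≤ D.index v := Nat.le_of_lt_succ hk
      rw [eval_some] at hx
      by_cases h0 : x (D.order (D.index v)) = 0
      · rw [if_pos h0] at hx
        have hlev := D.low_level v (left_ne_zero_of_mul hx)
        obtain ⟨e', he', hy⟩ := ih _ (Nat.lt_succ_of_le (D.low_level_le v)) (D.low v)
          (hlev ▸ hkv) (right_ne_zero_of_mul hx) rfl
        refine ⟨e', he', fun y hxy => ?_⟩
        rw [← hy y hxy, eval_some, if_pos ((hxy _ hkv).trans h0)]
        simp [left_ne_zero_of_mul hx]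
      · rw [if_neg h0] at hx
        have hlev := D.high_level v (left_ne_zero_of_mul hx)
        obtain ⟨e', he', hy⟩ := ih _ (Nat.lt_succ_of_le (D.high_level_le v)) (D.high v)
          (hlev ▸ hkv) (right_ne_zero_of_mul hx) rfl
        refine ⟨e', he', fun y hxy => ?_⟩
        rw [← hy y hxy, eval_some, if_neg (by rwa [hxy _ hkv])]
        simp [left_ne_zero_of_mul hx]

/-- A map sending each string of the support to an edge into level `k`, such that two strings with
the same edge can be spliced. -/
theorem exists_splicing_map (D : QMDD n) (k : ℕ) (hk : k ≤ n) :
    ∃ φ : BitString n → Option D.Node, ∀ x y z : BitString n, D.state x ≠ 0 → D.state y ≠ 0 →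
      φ x = φ y → (∀ i : Fin n, k ≤ i → z (D.order i) = x (D.order i)) →
      (∀ i : Fin n, (i : ℕ) < k → z (D.order i) = y (D.order i)) → D.state z ≠ 0 := by
  have hex : ∀ x : BitString n, ∃ e' : Option D.Node, D.eval x D.root ≠ 0 →
      ddLevel D.index e' = k ∧
      ∀ y : BitString n, (∀ i : Fin n, k ≤ i → y (D.order i) = x (D.order i)) →
        (D.eval y D.root ≠ 0 ↔ D.eval y e' ≠ 0) := by
    intro x
    by_cases hx : D.eval x D.root = 0
    -- Arbitrary value off the support.
    · exact ⟨none, fun h => absurd hx h⟩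
    · obtain ⟨e', he'⟩ := D.exists_edge_at_level k x D.root (by rwa [D.root_level]) hx
      exact ⟨e', fun _ => he'⟩
  choose φ hφ using hex
  refine ⟨φ, fun x y z hx hy hxy hzx hzy => ?_⟩
  obtain ⟨-, hx'⟩ := hφ x (right_ne_zero_of_mul hx)
  obtain ⟨hly, hy'⟩ := hφ y (right_ne_zero_of_mul hy)
  refine mul_ne_zero (left_ne_zero_of_mul hx) ((hx' z hzx).2 ?_)
  -- Below the shared edge only variables on which `z` agrees with `y` are read.
  rw [hxy, D.eval_congr (φ y) z y (fun i hi => hzy i (hly ▸ hi))]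
  exact (hy' y fun _ _ => rfl).1 (right_ne_zero_of_mul hy)

end QMDD

/-! ### Splitting a subspace along a set of variables -/

theorem cosetState_ne_zero_iff {n : ℕ} (V : Submodule (ZMod 2) (BitString n)) (x : BitString n) :
    cosetState (V : Set (BitString n)) x ≠ 0 ↔ x ∈ V := by
  classical
  have hcard : ((V : Set (BitString n)).ncard : ℝ) ≠ 0 := by
    have : (V : Set (BitString n)).ncard ≠ 0 :=
      Set.ncard_ne_zero_of_mem V.zero_mem
    exact_mod_cast this
  rw [cosetState, Pi.smul_apply, Finset.sum_apply, smul_eq_mul, mul_ne_zero_iff]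
  simp [ket, Pi.single_apply, -Set.ncard_eq_zero, hcard]

/-- Extension by zero of strings indexed by a set of variables. -/
noncomputable abbrev zeroExtend {n : ℕ} (A : Finset (Fin n)) :
    (A → ZMod 2) →ₗ[ZMod 2] BitString n :=
  Function.ExtendByZero.linearMap (ZMod 2) (Subtype.val : A → Fin n)

theorem zeroExtend_restrict {n : ℕ} (A : Finset (Fin n)) (x : BitString n)
    (hx : ∀ i ∉ A, x i = 0) : zeroExtend A (fun i => x i) = x := by
  ext i
  by_cases hi : i ∈ A
  · exact Subtype.val_injective.extend_apply (fun i : A => x i) 0 ⟨i, hi⟩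
  · rw [hx i hi]
    exact Function.extend_apply' (f := (Subtype.val : A → Fin n)) (fun i => x i)
      (0 : BitString n) i (by rintro ⟨a, ha⟩; exact hi (ha ▸ a.2))

/-- The part of `V` that splits along `A` and its complement. -/
noncomputable abbrev splitPart {n : ℕ} (V : Submodule (ZMod 2) (BitString n))
    (A : Finset (Fin n)) : Submodule (ZMod 2) (BitString n) :=
  (V.comap (zeroExtend A)).map (zeroExtend A) ⊔ (V.comap (zeroExtend Aᶜ)).map (zeroExtend Aᶜ)

theorem splitPart_le {n : ℕ} (V : Submodule (ZMod 2) (BitString n)) (A : Finset (Fin n)) :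
    splitPart V A ≤ V :=
  sup_le (Submodule.map_comap_le _ _) (Submodule.map_comap_le _ _)

theorem mem_map_comap_zeroExtend {n : ℕ} (V : Submodule (ZMod 2) (BitString n))
    (A : Finset (Fin n)) (x : BitString n) (hxV : x ∈ V) (hx : ∀ i ∉ A, x i = 0) :
    x ∈ (V.comap (zeroExtend A)).map (zeroExtend A) :=
  ⟨fun i => x i, by simpa only [SetLike.mem_coe, Submodule.mem_comap, zeroExtend_restrict A x hx],
    zeroExtend_restrict A x hx⟩

/-- If a small QMDD represents `|V⟩`, then `V` is close to its part that splits along a set of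
`n - k` variables. -/
theorem QMDD.exists_complement_card_le {n : ℕ} (V : Submodule (ZMod 2) (BitString n)) (D : QMDD n)
    (hD : D.state = cosetState (V : Set (BitString n))) (k : ℕ) (hk : k ≤ n) :
    ∃ A : Finset (Fin n), A.card = k ∧ ∃ W : Submodule (ZMod 2) (BitString n),
      splitPart V A ⊔ W = V ∧ Nat.card W ≤ D.size + 1 := by
  classical
  obtain ⟨φ, hφ⟩ := D.exists_splicing_map k hk
  simp only [hD, cosetState_ne_zero_iff] at hφ
  let A : Finset (Fin n) :=
    (Finset.univ.filter fun i : Fin n => (i : ℕ) < k).map D.order.toEmbedding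
  have hA : ∀ i, D.order i ∈ A ↔ (i : ℕ) < k := by simp [A]
  refine ⟨A, ?_, ?_⟩
  · simp [A, Fin.card_filter_val_lt, hk]
  -- The complement is taken in the interval below `V`, so that `W ≤ V`.
  obtain ⟨W', hW'⟩ := exists_isCompl (⟨splitPart V A, splitPart_le V A⟩ : Set.Iic V)
  obtain ⟨W, hWV⟩ := W'
  have hdisj : splitPart V A ⊓ W = ⊥ := congrArg Subtype.val hW'.inf_eq_bot
  refine ⟨W, congrArg Subtype.val hW'.sup_eq_top, ?_⟩
  have hinj : Function.Injective (fun w : W => φ w) := by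
    rintro ⟨x, hx⟩ ⟨y, hy⟩ hxy
    -- The splice: `x - z` is supported on `A` and `z - y` off `A`, so `x - y` lies in the split
    -- part.
    let z : BitString n := fun j => if j ∈ A then y j else x j
    have hz : z ∈ V := hφ x y z (hWV hx) (hWV hy) hxy
      (fun i hi => if_neg (by rw [hA]; omega)) (fun i hi => if_pos ((hA i).2 hi))
    have hxz : x - z ∈ splitPart V A := Submodule.mem_sup_left <|
      mem_map_comap_zeroExtend V A _ (V.sub_mem (hWV hx) hz) fun i hi => by simp [z, hi]
    have hzy : z - y ∈ splitPart V A := Submodule.mem_sup_right <|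
      mem_map_comap_zeroExtend V Aᶜ _ (V.sub_mem hz (hWV hy)) fun i hi => by
        simp [z, Finset.notMem_compl.1 hi]
    have hmem : x - y ∈ splitPart V A ⊓ W :=
      ⟨by simpa using add_mem hxz hzy, W.sub_mem hx hy⟩
    rw [hdisj, Submodule.mem_bot, sub_eq_zero] at hmem
    exact Subtype.ext hmem
  -- The `+ 1` in the bound accounts for the leaf `none`.
  have := Nat.card_le_card_of_injective _ hinj
  rwa [Nat.card_eq_fintype_card (α := Option D.Node), Fintype.card_option] at this

/-! ### Counting subspaces -/

/-- Every subspace is spanned by vectors in echelon form: there is a set `S` of coordinates such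
that it is spanned by the vectors `eᵢ + Mᵢ`, `i ∉ S`, with `Mᵢ` supported on `S`. -/
theorem Submodule.exists_span_echelon {K ι : Type*} [Field K] [Fintype ι] [DecidableEq ι]
    (W : Submodule K (ι → K)) :
    ∃ (S : Finset ι) (M : (Sᶜ : Finset ι) → S → K),
      W = span K (Set.range fun i : (Sᶜ : Finset ι) =>
        (Pi.single (i : ι) 1 + ∑ j : S, M i j • Pi.single (j : ι) 1 : ι → K)) := by
  -- `S` is a maximal set of coordinates whose unit vectors stay independent modulo `W`; every other
  -- unit vector is then a combination of these modulo `W`.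
  obtain ⟨T, -, -, hspan, hli⟩ := exists_linearIndepOn_extension
    (linearIndepOn_empty K fun i => W.mkQ (Pi.single i 1)) (Set.subset_univ _)
  obtain ⟨S, rfl⟩ := T.toFinite.exists_finset_coe
  have hzero : ∀ w ∈ W, (∀ i ∉ S, w i = 0) → w = 0 := by
    intro w hw hwS
    have hsum : w = ∑ j : S, w j • (Pi.single (j : ι) 1 : ι → K) := by
      rw [Finset.sum_coe_sort S fun j => w j • (Pi.single j 1 : ι → K),
        Finset.sum_subset S.subset_univ fun j _ hj => by rw [hwS j hj, zero_smul]]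
      exact pi_eq_sum_univ' w
    have hmk : ∑ j : S, w j • W.mkQ (Pi.single (j : ι) 1) = 0 := by
      have h := congrArg W.mkQ hsum
      rw [mkQ_apply, (Quotient.mk_eq_zero W).2 hw, _root_.map_sum] at h
      simpa only [_root_.map_smul] using h.symm
    have := Fintype.linearIndependent_iff.1 hli (fun j => w j) hmk
    ext i
    by_cases hi : i ∈ S
    · exact this ⟨i, hi⟩
    · exact hwS i hi
  have hc : ∀ i : ι, ∃ c : S → K, ∑ j, c j • W.mkQ (Pi.single (j : ι) 1) =
      W.mkQ (Pi.single i 1) := fun i => by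
    have := hspan ⟨i, Set.mem_univ i, rfl⟩
    rw [Set.image_eq_range] at this
    exact (mem_span_range_iff_exists_fun K).1 this
  choose c hc using hc
  refine ⟨S, fun i j => -c i j, le_antisymm (fun w hw => ?_) (span_le.2 ?_)⟩
  all_goals
    set g : (Sᶜ : Finset ι) → ι → K := fun i =>
      Pi.single (i : ι) 1 + ∑ j : S, -c i j • Pi.single (j : ι) 1 with hg
    have hgW : ∀ i, g i ∈ W := fun i => by
      rw [← Quotient.mk_eq_zero W, ← mkQ_apply, hg]
      simp only [map_add, _root_.map_sum, _root_.map_smul, neg_smul, Finset.sum_neg_distrib, hc,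
        _root_.map_neg, add_neg_cancel]
  -- Subtracting clears the coordinates outside `S`, and only `0` in `W` is supported on `S`.
  · have hr : w - ∑ i : (Sᶜ : Finset ι), w i • g i = 0 := by
      refine hzero _ (W.sub_mem hw (W.sum_mem fun i _ => W.smul_mem _ (hgW i))) fun k hk => ?_
      have hgk : ∀ i, g i k = if i = ⟨k, Finset.mem_compl.2 hk⟩ then 1 else 0 := fun i => by
        have : ∀ j : S, k ≠ j := fun j h => hk (h ▸ j.2)
        simp [hg, Pi.single_apply, this, Subtype.ext_iff, eq_comm]
      simp [hgk]
    rw [sub_eq_zero.1 hr]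
    exact sum_mem fun i _ => smul_mem _ _ (subset_span ⟨i, rfl⟩)
  · rintro _ ⟨i, rfl⟩
    exact hgW i

/-- An echelon form is a choice of `S` and of `|S|(m - |S|) ≤ m²/4` bits, where `m` is the number of
coordinates. -/
theorem Nat.card_submodule_le (ι : Type*) [Fintype ι] :
    Nat.card (Submodule (ZMod 2) (ι → ZMod 2)) ≤
      2 ^ (Fintype.card ι + Fintype.card ι ^ 2 / 4) := by
  classical
  let f : (Σ S : Finset ι, ((Sᶜ : Finset ι) → S → ZMod 2)) → Submodule (ZMod 2) (ι → ZMod 2) :=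
    fun p => Submodule.span _ (Set.range fun i : (p.1ᶜ : Finset ι) =>
        (Pi.single (i : ι) 1 + ∑ j : p.1, p.2 i j • Pi.single (j : ι) 1 : ι → ZMod 2))
  have hf : Function.Surjective f := fun W => by
    obtain ⟨S, M, h⟩ := W.exists_span_echelon
    exact ⟨⟨S, M⟩, h.symm⟩
  refine (Nat.card_le_card_of_surjective f hf).trans ?_
  rw [Nat.card_eq_fintype_card, Fintype.card_sigma, pow_add, ← Fintype.card_finset,
    ← smul_eq_mul, Fintype.card, ← Finset.sum_const]
  refine Finset.sum_le_sum fun S _ => ?_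
  rw [Fintype.card_fun, Fintype.card_fun, ZMod.card, Fintype.card_coe, Fintype.card_coe,
    Finset.card_compl, ← pow_mul]
  refine Nat.pow_le_pow_right two_pos ?_
  rw [Nat.le_div_iff_mul_le four_pos]
  obtain ⟨t, ht⟩ := Nat.exists_eq_add_of_le S.card_le_univ
  rw [ht, Nat.add_sub_cancel_left]
  exact_mod_cast (by nlinarith [sq_nonneg ((S.card : ℤ) - t)] :
    (S.card * t * 4 : ℤ) ≤ (S.card + t) ^ 2)

/-- Distinct linear maps have distinct graphs. -/
theorem Nat.le_card_submodule (a b : ℕ) :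
    2 ^ (a * b) ≤ Nat.card (Submodule (ZMod 2) (Fin (a + b) → ZMod 2)) := by
  let e : ((Fin a → ZMod 2) × (Fin b → ZMod 2)) ≃ₗ[ZMod 2] (Fin (a + b) → ZMod 2) :=
    LinearEquiv.ofFinrankEq _ _ (by simp)
  let f : ((Fin a → ZMod 2) →ₗ[ZMod 2] (Fin b → ZMod 2)) →
      Submodule (ZMod 2) (Fin (a + b) → ZMod 2) := fun g => g.graph.map (e : _ →ₗ[ZMod 2] _)
  have hf : Function.Injective f := fun g h hgh => by
    have hgraph : g.graph = h.graph := Submodule.map_injective_of_injective e.injective hgh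
    ext1 i
    ext1
    have := (g.mem_graph_iff (Pi.single i 1, g (Pi.single i 1))).2 rfl
    rw [hgraph, h.mem_graph_iff] at this
    simpa using this
  have := Nat.card_le_card_of_injective f hf
  rwa [Module.natCard_eq_pow_finrank (K := ZMod 2), Nat.card_zmod, Module.finrank_linearMap,
    Module.finrank_fin_fun, Module.finrank_fin_fun] at this

/-! ### Counting nearly split subspaces -/

/-- The subspaces spanned by a part splitting along some `k` variables and `q` further vectors. -/
def nearlySplit (n k q : ℕ) : Set (Submodule (ZMod 2) (BitString n)) :=
  {V | ∃ A : Finset (Fin n), A.card = k ∧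
    ∃ u : Fin q → BitString n, splitPart V A ⊔ Submodule.span _ (Set.range u) = V}

theorem ncard_nearlySplit_le (n k q : ℕ) :
    (nearlySplit n k q).ncard ≤
      2 ^ (n + ((k + k ^ 2 / 4) + ((n - k) + (n - k) ^ 2 / 4) + n * q)) := by
  classical
  let f : (A : Finset (Fin n)) → (Submodule (ZMod 2) (A → ZMod 2) ×
      Submodule (ZMod 2) ((Aᶜ : Finset (Fin n)) → ZMod 2)) × (Fin q → BitString n) →
      Submodule (ZMod 2) (BitString n) := fun A p =>
    p.1.1.map (zeroExtend A) ⊔ p.1.2.map (zeroExtend Aᶜ) ⊔ Submodule.span _ (Set.range p.2)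
  have hsub : nearlySplit n k q ⊆
      ⋃ A ∈ Finset.univ.filter (fun A : Finset (Fin n) => A.card = k), Set.range (f A) := by
    rintro V ⟨A, hA, u, hu⟩
    simp only [Finset.mem_filter, Finset.mem_univ, true_and, Set.mem_iUnion]
    exact ⟨A, hA, ⟨(V.comap (zeroExtend A), V.comap (zeroExtend Aᶜ)), u⟩, hu⟩
  refine (Set.ncard_le_ncard hsub (Set.toFinite _)).trans
    ((Finset.set_ncard_biUnion_le _ _).trans ?_)
  have hle : ∀ A ∈ Finset.univ.filter (fun A : Finset (Fin n) => A.card = k),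
      (Set.range (f A)).ncard ≤ 2 ^ ((k + k ^ 2 / 4) + ((n - k) + (n - k) ^ 2 / 4) + n * q) := by
    intro A hA
    have hA : A.card = k := (Finset.mem_filter.1 hA).2
    have h1 := Nat.card_submodule_le A
    have h2 := Nat.card_submodule_le (Aᶜ : Finset (Fin n))
    rw [Fintype.card_coe, hA] at h1
    rw [Fintype.card_coe, Finset.card_compl, Fintype.card_fin, hA] at h2
    rw [← Nat.card_coe_set_eq]
    refine (Finite.card_range_le (f A)).trans ?_
    rw [Nat.card_prod, Nat.card_prod, pow_add, pow_add]
    refine Nat.mul_le_mul (Nat.mul_le_mul h1 h2) (le_of_eq ?_)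
    simp [pow_mul]
  refine (Finset.sum_le_card_nsmul _ _ _ hle).trans ?_
  rw [smul_eq_mul, pow_add 2 n]
  refine Nat.mul_le_mul_right _ ?_
  -- The number of sets `A` is bounded crudely by `2 ^ n`.
  exact (Finset.card_filter_le _ _).trans (by simp)

theorem Submodule.exists_span_range_eq {K E : Type*} [Field K] [AddCommGroup E] [Module K E]
    (W : Submodule K E) [FiniteDimensional K W] (q : ℕ) (hq : Module.finrank K W ≤ q) :
    ∃ u : Fin q → E, span K (Set.range u) = W := by
  obtain ⟨r, rfl⟩ := Nat.exists_eq_add_of_le hq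
  refine ⟨Fin.append (fun i => (Module.finBasis K W i : E)) 0, ?_⟩
  have hbasis : span K (Set.range fun i => (Module.finBasis K W i : E)) = W := by
    have := congrArg (map W.subtype) (Module.finBasis K W).span_eq
    rwa [map_span, ← Set.range_comp, map_subtype_top] at this
  refine le_antisymm (span_le.2 ?_) ?_
  · rintro _ ⟨i, rfl⟩
    refine Fin.addCases (fun i => ?_) (fun i => ?_) i <;> simp
  · conv_lhs => rw [← hbasis]
    refine span_mono ?_
    rintro _ ⟨i, rfl⟩
    exact ⟨Fin.castAdd r i, Fin.append_left _ _ i⟩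

theorem mem_nearlySplit_of_card_le {n k q : ℕ} (hk : k ≤ n)
    (V : Submodule (ZMod 2) (BitString n)) (D : QMDD n)
    (hD : D.state = cosetState (V : Set (BitString n))) (hq : D.size + 1 < 2 ^ (q + 1)) :
    V ∈ nearlySplit n k q := by
  obtain ⟨A, hA, W, hW, hcard⟩ := D.exists_complement_card_le V hD k hk
  rw [Module.natCard_eq_pow_finrank (K := ZMod 2), Nat.card_zmod] at hcard
  have hlt := (Nat.pow_lt_pow_iff_right one_lt_two).1 (hcard.trans_lt hq)
  obtain ⟨u, hu⟩ := W.exists_span_range_eq q (Nat.le_of_lt_succ hlt)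
  exact ⟨A, hA, u, by rw [hu, hW]⟩

/-- Up to rounding, the exponents to compare are `3n + n²/8 + n²/16` and `n²/4`; the slack `n²/16`
absorbs `3n` once `n ≥ 64`. -/
theorem ncard_nearlySplit_mul_le (n : ℕ) (hn : 64 ≤ n) :
    (nearlySplit n (n / 2) (n / 16)).ncard * 2 ^ n ≤
      Nat.card (Submodule (ZMod 2) (BitString n)) := by
  have hcount := ncard_nearlySplit_le n (n / 2) (n / 16)
  have htot := Nat.le_card_submodule (n / 2) (n - n / 2)
  rw [Nat.add_sub_cancel' (Nat.div_le_self n 2)] at htot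
  refine (Nat.mul_le_mul_right _ hcount).trans (le_trans ?_ htot)
  rw [← pow_add]
  refine Nat.pow_le_pow_right two_pos ?_
  obtain ⟨a, ha⟩ : ∃ a, a = n / 2 := ⟨_, rfl⟩
  obtain ⟨b, hb⟩ : ∃ b, b = n - n / 2 := ⟨_, rfl⟩
  obtain ⟨q, hq⟩ : ∃ q, q = n / 16 := ⟨_, rfl⟩
  rw [← hb, ← ha, ← hq]
  have h1 : a ^ 2 / 4 * 4 ≤ a ^ 2 := Nat.div_mul_le_self _ _
  have h2 : b ^ 2 / 4 * 4 ≤ b ^ 2 := Nat.div_mul_le_self _ _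
  have hnab : n = a + b := by omega
  have h3 : 16 * q ≤ a + b := by omega
  have h4 : a ≤ b ∧ b ≤ a + 1 ∧ 32 ≤ a := by omega
  subst hnab
  nlinarith [Nat.mul_le_mul_left (a + b) h3]

/-! ### Conclusion -/

theorem mainTheorem8 :
    ∃ c : ℝ, 0 < c ∧
      Tendsto
        (fun n : ℕ => subspaceProb n (fun V =>
          ∀ D : QMDD n, D.state = cosetState (V : Set (BitString n)) →
            (2 : ℝ) ^ (c * (n : ℝ)) / (2 * (n : ℝ)) ≤ (D.size : ℝ)))
        atTop (𝓝 1) := by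
  refine ⟨1 / 16, by norm_num, ?_⟩
  have hlow : Tendsto (fun n : ℕ => 1 - (1 / 2 : ℝ) ^ n) atTop (𝓝 1) := by
    simpa using (tendsto_pow_atTop_nhds_zero_of_lt_one (by norm_num : (0 : ℝ) ≤ 1 / 2)
      (by norm_num)).const_sub 1
  refine tendsto_of_tendsto_of_tendsto_of_le_of_le' hlow tendsto_const_nhds ?_
    (Eventually.of_forall fun n => ?_)
  · filter_upwards [eventually_ge_atTop 64] with n hn
    set P : Submodule (ZMod 2) (BitString n) → Prop := fun V =>
      ∀ D : QMDD n, D.state = cosetState (V : Set (BitString n)) →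
        (2 : ℝ) ^ (1 / 16 * (n : ℝ)) / (2 * (n : ℝ)) ≤ (D.size : ℝ) with hP
    have hbad : {V | P V}ᶜ ⊆ nearlySplit n (n / 2) (n / 16) := by
      intro V hV
      simp only [Set.mem_compl_iff, Set.mem_ofPred_eq, hP, not_forall, not_le] at hV
      obtain ⟨D, hD, hlt⟩ := hV
      refine mem_nearlySplit_of_card_le (Nat.div_le_self _ _) V D hD ?_
      have hn' : (64 : ℝ) ≤ n := by exact_mod_cast hn
      have h2 : (2 : ℝ) ≤ 2 ^ (1 / 16 * (n : ℝ)) := by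
        calc (2 : ℝ) = 2 ^ (1 : ℝ) := (Real.rpow_one 2).symm
          _ ≤ _ := Real.rpow_le_rpow_of_exponent_le (by norm_num) (by linarith)
      have h3 : (2 : ℝ) ^ (1 / 16 * (n : ℝ)) / (2 * n) ≤ 2 ^ (1 / 16 * (n : ℝ)) / 2 :=
        div_le_div_of_nonneg_left (by positivity) (by norm_num) (by linarith)
      have h4 : (2 : ℝ) ^ (1 / 16 * (n : ℝ)) ≤ 2 ^ (n / 16 + 1) := by
        rw [← Real.rpow_natCast]
        refine Real.rpow_le_rpow_of_exponent_le (by norm_num) ?_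
        have : n < 16 * (n / 16 + 1) := by omega
        have : (n : ℝ) < 16 * ((n / 16 + 1 : ℕ) : ℝ) := by exact_mod_cast this
        linarith
      -- With `t = 2^(n/16) ≥ 2`, the size is below `t/2`, so size plus one is below `t/2 + 1 ≤ t`.
      have : ((D.size + 1 : ℕ) : ℝ) < ((2 ^ (n / 16 + 1) : ℕ) : ℝ) := by
        push_cast
        linarith
      exact_mod_cast this
    have hle := Set.ncard_le_ncard hbad (Set.toFinite _)
    have hadd := Set.ncard_add_ncard_compl {V | P V}
    have hmul := ncard_nearlySplit_mul_le n hn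
    have hpos : 0 < Nat.card (Submodule (ZMod 2) (BitString n)) := Nat.card_pos
    rw [subspaceProb, le_div_iff₀ (by exact_mod_cast hpos)]
    change _ ≤ (({V | P V}.ncard : ℕ) : ℝ)
    have hle' : (({V | P V}ᶜ.ncard : ℕ) : ℝ) * 2 ^ n ≤
        (Nat.card (Submodule (ZMod 2) (BitString n)) : ℝ) := by
      exact_mod_cast (Nat.mul_le_mul_right _ hle).trans hmul
    have hadd' : (({V | P V}.ncard : ℕ) : ℝ) + (({V | P V}ᶜ.ncard : ℕ) : ℝ) =
        (Nat.card (Submodule (ZMod 2) (BitString n)) : ℝ) := by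
      exact_mod_cast hadd
    rw [← le_div_iff₀ (by positivity)] at hle'
    rw [one_div, inv_pow, sub_mul, one_mul, inv_mul_eq_div]
    linarith
  · rw [subspaceProb]
    refine div_le_one_of_le₀ ?_ (Nat.cast_nonneg _)
    exact_mod_cast Finite.card_subtype_le _
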